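/- \textbf{Setting.} Let $L,H,d_a,d_x,V,N$ be natural numbers with $d_x=H\,d_a$. The weights of the (softmax-free) $H$-headed self-attention network of depth $L$ and width $d_x$ over a vocabulary $[V]$ are real matrices $W^{K,l,h},W^{Q,l,h},W^{V,l,h}\in\mathbb R^{d_a\times d_x}$, $W^{O,l,h}\in\mathbb R^{d_x\times d_a}$ ($l\in[L]$, $h\in[H]$) and an embedding matrix $M\in\mathbb R^{d_x\times V}$ with columns $M_w$, $w\in[V]$. On input vectors $x^1,\dots,x^n\in\mathbb R^{d_x}$ the network computes $g^{i,0}=x^i$ and $$g^{i,l}=\sum_{h=1}^H W^{O,l,h}\sum_{j=1}^n\big\langle W^{Q,l,h}g^{i,l-1},W^{K,l,h}g^{j,l-1}\big\rangle W^{V,l,h}g^{j,l-1}\qquad(1\le l\le L).$$ For two sentences $S_1=(w_1^1,\dots,w_1^N)$, $S_2=(w_2^1,\dots,w_2^N)$ of words in $[V]$, the in-context representation $y^{(p,i),L,d_x}_{\text{in-context}}$ is the $p$-th entry of $g^{i,L}$ on the $2N$ inputs $M_{w_1^1},\dots,M_{w_1^N},M_{w_2^1},\dots,M_{w_2^N}$.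 Let $\mathcal Z(a,b)$, $a,b\in\mathbb R^{d_x}$, be the $p$-th entry of $g^{i,L}$ on the inputs $M_{w_1^1}\odot a,\dots,M_{w_1^N}\odot a,\,M_{w_2^1}\odot b,\dots,M_{w_2^N}\odot b$, where $\odot$ is the entrywise product. The separation rank $\mathrm{sep}(f)$ of $f:\mathbb R^{d_x}\times\mathbb R^{d_x}\to\mathbb R$ is the least $R\in\mathbb N$ such that $f(a,b)=\sum_{r=1}^R g_r(a)g'_r(b)$ for some functions $g_r,g'_r:\mathbb R^{d_x}\to\mathbb R$ ($\infty$ if there is none). The $\varepsilon$-sequential-separation rank $\varepsilon\text{-seq-sep}\big(y^{(p,i),L,d_x}_{\text{in-context}}\big)$ is the least $R'\in\mathbb N$ with $R'\le\mathrm{sep}(\mathcal Z)$ for which there is $\tilde y:\mathbb R^{d_x}\times\mathbb R^{d_x}\to\mathbb R$ with $\mathrm{sep}(\tilde y)=R'$ and $|\tilde y(a,b)-\mathcal Z(a,b)|\le\varepsilon$ for all $a,b$ ($\infty$ if there is none). \textbf{Theorem 2.} Assume $L>\log_3 d_x$. For every output entry $p\in[d_x]$ and position $i\in[2N]$ there is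 an assignment of the network weights (including $M$) such that, for all sentences $S_1,S_2\in[V]^N$, $$\log\Big[\varepsilon\text{-seq-sep}\big(y^{(p,i),L,d_x}_{\text{in-context}}\big)\Big]=\tilde\Omega(L\cdot d_x)\qquad\text{whenever } 0<\varepsilon=\tilde O\left(\binom{3^L+d_x-1}{3^L}^{-1}\right),$$ where $\tilde O,\tilde\Omega$ omit powers of $\log d_x,\log L,\log H$. Explicitly: for all $C>0$ and $m\in\mathbb N$ there are $c>0$ and $k\in\mathbb N$ such that for all $L,H,d_a,d_x,V,N$ as above with $L>\log_3 d_x$ and all $p\in[d_x]$, $i\in[2N]$ there are weights such that for all $S_1,S_2\in[V]^N$ and all $\varepsilon$ with $0<\varepsilon\le C\,\Lambda^m\binom{3^L+d_x-1}{3^L}^{-1}$, $$\log\Big[\varepsilon\text{-seq-sep}\big(y^{(p,i),L,d_x}_{\text{in-context}}\big)\Big]\ \ge\ \frac{c\,L\,d_x}{\Lambda^k},\qquad \Lambda:=1+\log d_x+\log L+\log H .$$ -/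

import Mathlib

namespace InContext

/-- Key, query, value and output matrices of one `H`-headed self-attention layer of width `dx`
and head dimension `da`. -/
structure LayerWeights (H dx da : ℕ) where
  K : Fin H → Matrix (Fin da) (Fin dx) ℝ
  Q : Fin H → Matrix (Fin da) (Fin dx) ℝ
  V : Fin H → Matrix (Fin da) (Fin dx) ℝ
  O : Fin H → Matrix (Fin dx) (Fin da) ℝ

/-- All learned weights of a depth-`L` network over a vocabulary of size `V`: the weights of the
`L` layers and the vocabulary embedding matrix. -/
structure Weights (L H dx da V : ℕ) where
  layer : Fin L → LayerWeights H dx da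
  emb : Matrix (Fin dx) (Fin V) ℝ

/-- One self-attention layer (no softmax) on a sequence of `n` vectors:
`gⁱ ↦ ∑ₕ W^{O,h} ∑ⱼ ⟨W^{Q,h} gⁱ, W^{K,h} gʲ⟩ W^{V,h} gʲ`. -/
def attnLayer {H dx da n : ℕ} (W : LayerWeights H dx da) (g : Fin n → Fin dx → ℝ) :
    Fin n → Fin dx → ℝ :=
  fun i => ∑ h, (W.O h).mulVec
    (∑ j, (((W.Q h).mulVec (g i)) ⬝ᵥ ((W.K h).mulVec (g j))) • (W.V h).mulVec (g j))

/-- The depth-`L` self-attention stack applied to `n` input vectors. -/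
def attnStack {H dx da n : ℕ} : (L : ℕ) → (Fin L → LayerWeights H dx da) →
    (Fin n → Fin dx → ℝ) → (Fin n → Fin dx → ℝ)
  | 0, _, x => x
  | L + 1, W, x => attnLayer (W (Fin.last L)) (attnStack L (fun l => W l.castSucc) x)

/-- The embedding of the word `w`: the `w`-th column of the vocabulary matrix. -/
def embed {dx V : ℕ} (M : Matrix (Fin dx) (Fin V) ℝ) (w : Fin V) : Fin dx → ℝ :=
  fun p => M p w

/-- The network on a sequence of words. -/
def transformer {L H dx da V n : ℕ} (W : Weights L H dx da V) (w : Fin n → Fin V) :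
    Fin n → Fin dx → ℝ :=
  attnStack L W.layer (fun j => embed W.emb (w j))

/-- The in-context representation: the two sentences are concatenated in the input. -/
def inContext {L H dx da V N : ℕ} (W : Weights L H dx da V) (S₁ S₂ : Fin N → Fin V)
    (i : Fin (N + N)) (p : Fin dx) : ℝ :=
  transformer W (Fin.append S₁ S₂) i p

/-- The in-context representation with the sentence association layer: each use of the embedding
of a word of the first (second) sentence is multiplied entrywise by `a` (by `b`). -/
def inContextAssoc {L H dx da V N : ℕ} (W : Weights L H dx da V) (S₁ S₂ : Fin N → Fin V)
    (i : Fin (N + N)) (p : Fin dx) (a b : Fin dx → ℝ) : ℝ :=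
  attnStack L W.layer
    (Fin.append (fun j => embed W.emb (S₁ j) * a) (fun j => embed W.emb (S₂ j) * b)) i p

/-- With all-ones association vectors the in-context representation is recovered. -/
theorem inContextAssoc_one {L H dx da V N : ℕ} (W : Weights L H dx da V)
    (S₁ S₂ : Fin N → Fin V) (i : Fin (N + N)) (p : Fin dx) :
    inContextAssoc W S₁ S₂ i p 1 1 = inContext W S₁ S₂ i p := by
  unfold inContextAssoc inContext transformer
  congr 2
  funext j
  refine Fin.addCases (fun j => ?_) (fun j => ?_) j
  · rw [Fin.append_left, Fin.append_left, mul_one]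
  · rw [Fin.append_right, Fin.append_right, mul_one]

/-- The separation rank of `y(A, B)`: the least number of products `g(A) * g'(B)` that sum to `y`
(`⊤` if there is no such finite number). -/
noncomputable def sepRank {α β : Type*} (y : α → β → ℝ) : ℕ∞ :=
  sInf {R : ℕ∞ | ∃ n : ℕ, R = n ∧ ∃ (g : Fin n → α → ℝ) (g' : Fin n → β → ℝ),
    ∀ A B, y A B = ∑ r, g r A * g' r B}

/-- The `ε`-separation rank: the least finite separation rank, not exceeding that of `y`, of a
function that is uniformly `ε`-close to `y` (`⊤` if there is none). -/
noncomputable def epsSepRank {α β : Type*} (ε : ℝ) (y : α → β → ℝ) : ℕ∞ :=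
  sInf {R : ℕ∞ | ∃ n : ℕ, R = n ∧ (n : ℕ∞) ≤ sepRank y ∧
    ∃ y' : α → β → ℝ, sepRank y' = n ∧ ∀ A B, |y' A B - y A B| ≤ ε}

/-- The `ε`-sequential-separation rank of the `p`-th entry, at position `i`, of the in-context
representation of `S₁` and `S₂`. -/
noncomputable def epsSeqSep {L H dx da V N : ℕ} (ε : ℝ) (W : Weights L H dx da V)
    (S₁ S₂ : Fin N → Fin V) (i : Fin (N + N)) (p : Fin dx) : ℕ∞ :=
  epsSepRank ε (inContextAssoc W S₁ S₂ i p)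

/-- The logarithmic terms that are omitted in soft asymptotic notation. -/
noncomputable def logTerms (L dx H : ℕ) : ℝ :=
  1 + Real.log dx + Real.log L + Real.log H

end InContext

open Polynomial Filter Topology

/-! ### Separation rank and nonsingular matrices of values -/

namespace InContext

/-! The output is homogeneous of degree `3 ^ L` in the pair of association vectors, so a bounded
error disappears after rescaling at large arguments. Hence every uniform approximation has
separation rank at least the size of any nonsingular matrix of values `y (A r) (B s)`
(`le_epsSepRank_of_det_ne_zero`). It is enough to find weights and sequences `A`, `B` along which
the output is, up to nonzero row and column factors, a polynomial in `q ^ (r + s)`: the matrix then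
factors through two Vandermonde matrices and may be as large as the number of monomials
(`card_support_le_epsSepRank`).

For width above 9, averaging mixes the two sentences, pairing turns a coordinate of `a` times a
coordinate of `b` into `z ^ B ^ s`, and the remaining `l = L - 2` layers multiply `3 ^ l` sums of
such monomials in a ternary tree (`attnStack_treeLayers`). Coefficients are natural numbers, so
nothing cancels; each of `J ≈ dx / 9` powers `B ^ s` is available in `B - 1` factors of its own, so
base-`B` digits give every exponent below `B ^ J` (`coeff_prod_blockPoly_ne_zero`). As `B * dx ≥ 3 ^
l`, the number `J * log B` is of order `L * dx` up to a logarithm (`log_pow_ge`). For width at most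
9 a single coordinate already gives rank `2 ^ L`. -/

theorem exists_of_sepRank_eq {α β : Type*} {y : α → β → ℝ} {n : ℕ} (h : sepRank y = n) :
    ∃ (g : Fin n → α → ℝ) (g' : Fin n → β → ℝ), ∀ A B, y A B = ∑ r, g r A * g' r B := by
  have hne : {R : ℕ∞ | ∃ n : ℕ, R = n ∧ ∃ (g : Fin n → α → ℝ) (g' : Fin n → β → ℝ),
      ∀ A B, y A B = ∑ r, g r A * g' r B}.Nonempty := by
    by_contra hne
    rw [Set.not_nonempty_iff_eq_empty] at hne
    rw [sepRank, hne, sInf_empty] at h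
    exact ENat.top_ne_natCast n h
  -- `ℕ∞` is well-ordered, so the infimum of a nonempty set is attained.
  obtain ⟨k, hk, hg⟩ := csInf_mem hne
  have hkn : k = n := by
    have : (n : ℕ∞) = k := h.symm.trans hk
    exact_mod_cast this.symm
  subst hkn
  exact hg

/-- A matrix of values of a function of separation rank `n` that is nonsingular has size at
most `n`. -/
theorem le_of_det_ne_zero {α β : Type*} {y : α → β → ℝ} {n R : ℕ} (h : sepRank y = n)
    (A : Fin R → α) (B : Fin R → β) (hdet : (Matrix.of fun r s => y (A r) (B s)).det ≠ 0) :
    R ≤ n := by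
  obtain ⟨g, g', hy⟩ := exists_of_sepRank_eq h
  have hmul : (Matrix.of fun r s => y (A r) (B s)) =
      (Matrix.of fun r k => g k (A r)) * (Matrix.of fun k s => g' k (B s)) := by
    ext r s
    simp [Matrix.mul_apply, hy]
  have hunit : IsUnit (Matrix.of fun r s => y (A r) (B s)) :=
    (Matrix.isUnit_iff_isUnit_det _).2 hdet.isUnit
  have hrank := Matrix.rank_of_isUnit _ hunit
  rw [Fintype.card_fin, hmul] at hrank
  calc R = _ := hrank.symm
    _ ≤ _ := Matrix.rank_mul_le_left _ _
    _ ≤ Fintype.card (Fin n) := Matrix.rank_le_card_width _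
    _ = n := Fintype.card_fin n

/-- For a homogeneous function, uniform approximation does not lower the rank of a matrix of
values: the error is negligible at large arguments. -/
theorem le_epsSepRank_of_det_ne_zero {E F : Type*} [AddCommGroup E] [Module ℝ E]
    [AddCommGroup F] [Module ℝ F] {y : E → F → ℝ} {m R : ℕ} (hm : m ≠ 0)
    (hom : ∀ (t : ℝ) A B, y (t • A) (t • B) = t ^ m * y A B) (A : Fin R → E) (B : Fin R → F)
    (hdet : (Matrix.of fun r s => y (A r) (B s)).det ≠ 0) (ε : ℝ) :
    (R : ℕ∞) ≤ epsSepRank ε y := by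
  refine le_sInf ?_
  rintro _ ⟨n, rfl, -, y', hn, hy'⟩
  -- By homogeneity the rescaled entry differs from `y (A r) (B s)` by at most `ε / t ^ m`;
  -- nonvanishing of the determinant is an open condition.
  have hconv : Tendsto (fun t : ℝ => (Matrix.of fun r s =>
      (t ^ m)⁻¹ * y' (t • A r) (t • B s)).det) atTop
      (𝓝 (Matrix.of fun r s => y (A r) (B s)).det) := by
    have hc : Continuous fun M : Matrix (Fin R) (Fin R) ℝ => M.det := by fun_prop
    refine (hc.tendsto _).comp ?_
    refine tendsto_pi_nhds.2 fun r => tendsto_pi_nhds.2 fun s => ?_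
    have hzero : Tendsto (fun t : ℝ => ε * (t ^ m)⁻¹) atTop (𝓝 0) := by
      simpa using (tendsto_inv_atTop_zero.comp (tendsto_pow_atTop (α := ℝ) hm)).const_mul ε
    rw [tendsto_iff_dist_tendsto_zero]
    refine squeeze_zero' (Eventually.of_forall fun _ => dist_nonneg) ?_ hzero
    filter_upwards [eventually_gt_atTop (0 : ℝ)] with t ht
    have htm : 0 < t ^ m := pow_pos ht m
    have hb := hy' (t • A r) (t • B s)
    rw [hom] at hb
    have heq : (t ^ m)⁻¹ * y' (t • A r) (t • B s) - y (A r) (B s) =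
        (y' (t • A r) (t • B s) - t ^ m * y (A r) (B s)) * (t ^ m)⁻¹ := by
      field_simp
    simp only [Matrix.of_apply, Real.dist_eq]
    rw [heq, abs_mul, abs_of_pos (inv_pos.2 htm)]
    exact mul_le_mul_of_nonneg_right hb (inv_pos.2 htm).le
  have hev := (hconv.eventually_ne hdet).and (eventually_gt_atTop (0 : ℝ))
  obtain ⟨t, ht, -⟩ := hev.exists
  have hsc : (Matrix.of fun r s => (t ^ m)⁻¹ * y' (t • A r) (t • B s)) =
      (t ^ m)⁻¹ • (Matrix.of fun r s => y' (t • A r) (t • B s)) := by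
    ext r s
    simp
  rw [hsc, Matrix.det_smul] at ht
  exact_mod_cast le_of_det_ne_zero hn (fun r => t • A r) (fun s => t • B s)
    (right_ne_zero_of_mul ht)

/-- The Hankel matrix of the values of a polynomial at the powers of `q > 1` is nonsingular when
its size is the number of monomials. -/
theorem det_eval_pow_ne_zero (P : ℝ[X]) {q : ℝ} (hq : 1 < q) {R : ℕ} (hR : P.support.card = R) :
    (Matrix.of fun r s : Fin R => P.eval (q ^ (r : ℕ) * q ^ (s : ℕ))).det ≠ 0 := by
  let e := P.support.orderEmbOfFin hR
  let v : Fin R → ℝ := fun k => q ^ (e k)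
  have hv : Function.Injective v := fun i j h =>
    e.injective (pow_right_injective₀ (by linarith) hq.ne' h)
  -- Each monomial of `P` contributes a rank-one matrix; the nodes `q ^ e k` are distinct because `q
  -- > 1`.
  have hmul : (Matrix.of fun r s : Fin R => P.eval (q ^ (r : ℕ) * q ^ (s : ℕ))) =
      (Matrix.vandermonde v).transpose * Matrix.diagonal (fun k => P.coeff (e k)) *
        Matrix.vandermonde v := by
    ext r s
    rw [Matrix.mul_apply, Matrix.of_apply, eval_eq_sum, Polynomial.sum]
    have himg : P.support = Finset.univ.map e.toEmbedding :=
      (Finset.map_orderEmbOfFin_univ P.support hR).symm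
    conv_lhs => rw [himg]
    rw [Finset.sum_map]
    refine Finset.sum_congr rfl fun k _ => ?_
    simp only [Matrix.mul_diagonal, Matrix.transpose_apply, Matrix.vandermonde_apply, v]
    simp only [RelEmbedding.coe_toEmbedding]
    rw [← pow_mul, ← pow_mul, mul_comm (e k) (r : ℕ), mul_comm (e k) (s : ℕ), mul_pow, pow_mul,
      pow_mul]
    ring
  have hvd := Matrix.det_vandermonde_ne_zero_iff.2 hv
  rw [hmul, Matrix.det_mul, Matrix.det_mul, Matrix.det_transpose, Matrix.det_diagonal]
  refine mul_ne_zero (mul_ne_zero hvd (Finset.prod_ne_zero_iff.2 fun k _ => ?_)) hvd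
  exact mem_support_iff.1 (P.support.orderEmbOfFin_mem hR k)

theorem card_support_le_epsSepRank {E F : Type*} [AddCommGroup E] [Module ℝ E]
    [AddCommGroup F] [Module ℝ F] {y : E → F → ℝ} {m : ℕ} (hm : m ≠ 0)
    (hom : ∀ (t : ℝ) A B, y (t • A) (t • B) = t ^ m * y A B) (P : ℝ[X]) {q : ℝ} (hq : 1 < q)
    (A : ℕ → E) (B : ℕ → F) (w w' : ℕ → ℝ) (hw : ∀ r, w r ≠ 0) (hw' : ∀ s, w' s ≠ 0)
    (hy : ∀ r s, y (A r) (B s) = w r * P.eval (q ^ r * q ^ s) * w' s) (ε : ℝ) :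
    (P.support.card : ℕ∞) ≤ epsSepRank ε y := by
  refine le_epsSepRank_of_det_ne_zero hm hom (fun r : Fin P.support.card => A r)
    (fun s : Fin P.support.card => B s) ?_ ε
  have hmul : (Matrix.of fun r s : Fin P.support.card => y (A r) (B s)) =
      Matrix.diagonal (fun r : Fin P.support.card => w r) *
        (Matrix.of fun r s : Fin P.support.card => P.eval (q ^ (r : ℕ) * q ^ (s : ℕ))) *
        Matrix.diagonal (fun s : Fin P.support.card => w' s) := by
    ext r s
    simp [Matrix.mul_diagonal, Matrix.diagonal_mul, hy]
  rw [hmul, Matrix.det_mul, Matrix.det_mul, Matrix.det_diagonal, Matrix.det_diagonal]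
  exact mul_ne_zero (mul_ne_zero (Finset.prod_ne_zero_iff.2 fun k _ => hw _)
    (det_eval_pow_ne_zero P hq rfl)) (Finset.prod_ne_zero_iff.2 fun s _ => hw' (s : ℕ))

/-! ### Monomials of products of polynomials over `ℕ` -/

/-- If all coefficients of index below `R` of a polynomial over `ℕ` are nonzero, then it has at
least `R` monomials over `ℝ`. -/
theorem le_card_support_map {P : ℕ[X]} {R : ℕ} (h : ∀ k < R, P.coeff k ≠ 0) :
    R ≤ (P.map (Nat.castRingHom ℝ)).support.card := by
  calc R = (Finset.range R).card := (Finset.card_range R).symm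
    _ ≤ _ := Finset.card_le_card fun k hk => by
      rw [mem_support_iff, coeff_map]
      simpa using h k (Finset.mem_range.1 hk)

/-- Over `ℕ` there is no cancellation, so one nonzero term of the convolution is enough. -/
theorem coeff_mul_ne_zero {P Q : ℕ[X]} {a b : ℕ} (hP : P.coeff a ≠ 0) (hQ : Q.coeff b ≠ 0) :
    (P * Q).coeff (a + b) ≠ 0 := by
  rw [coeff_mul]
  have h := Finset.single_le_sum (f := fun x : ℕ × ℕ => P.coeff x.1 * Q.coeff x.2)
    (fun _ _ => Nat.zero_le _) (Finset.HasAntidiagonal.mem_antidiagonal.2 (rfl : (a, b).1 + (a, b).2 = a + b))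
  have : 0 < P.coeff a * Q.coeff b := Nat.pos_of_ne_zero (mul_ne_zero hP hQ)
  exact (this.trans_le h).ne'

theorem coeff_prod_zero_ne_zero {ι : Type*} (s : Finset ι) (P : ι → ℕ[X])
    (h : ∀ i ∈ s, (P i).coeff 0 ≠ 0) : (∏ i ∈ s, P i).coeff 0 ≠ 0 := by
  rw [coeff_zero_prod]
  exact Finset.prod_ne_zero_iff.2 h

/-- Take the monomial of degree `a` from `d` of the factors and the constant term from the others.
-/
theorem coeff_pow_ne_zero {P : ℕ[X]} {a : ℕ} (h0 : P.coeff 0 ≠ 0) (ha : P.coeff a ≠ 0)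
    {E d : ℕ} (hd : d ≤ E) : (P ^ E).coeff (d * a) ≠ 0 := by
  induction E generalizing d with
  | zero => simp [Nat.le_zero.1 hd]
  | succ E ih =>
    rw [pow_succ]
    rcases d with _ | d
    · simpa using coeff_mul_ne_zero (ih (Nat.zero_le E)) h0
    · rw [Nat.succ_mul]
      exact coeff_mul_ne_zero (ih (Nat.le_of_succ_le_succ hd)) ha

/-- Digit expansions in base `E + 1`. -/
theorem coeff_prod_pow_ne_zero (P : ℕ → ℕ[X]) (E J : ℕ) (h0 : ∀ s < J, (P s).coeff 0 ≠ 0)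
    (h1 : ∀ s < J, (P s).coeff ((E + 1) ^ s) ≠ 0) :
    ∀ k < (E + 1) ^ J, (∏ s ∈ Finset.range J, P s ^ E).coeff k ≠ 0 := by
  induction J with
  | zero =>
    intro k hk
    have : k = 0 := by simpa using hk
    simp [this]
  | succ J ih =>
    intro k hk
    rw [Finset.prod_range_succ]
    have hpos : 0 < (E + 1) ^ J := by positivity
    -- The leading digit of `k` is left to the last factor, the remainder to the induction
    -- hypothesis.
    have hd : k / (E + 1) ^ J ≤ E := by
      rw [pow_succ'] at hk
      exact Nat.le_of_lt_succ ((Nat.div_lt_iff_lt_mul hpos).2 hk)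
    have h := coeff_mul_ne_zero
      (ih (fun s hs => h0 s (hs.trans J.lt_succ_self)) (fun s hs => h1 s (hs.trans J.lt_succ_self))
        (k % (E + 1) ^ J) (Nat.mod_lt _ hpos))
      (coeff_pow_ne_zero (h0 J J.lt_succ_self) (h1 J J.lt_succ_self) hd)
    rwa [mul_comm (k / _), Nat.mod_add_div] at h

/-! ### Homogeneity, and inputs independent of the words -/

theorem attnLayer_smul {H dx da n : ℕ} (W : LayerWeights H dx da) (t : ℝ)
    (g : Fin n → Fin dx → ℝ) : attnLayer W (t • g) = t ^ 3 • attnLayer W g := by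
  funext i
  simp only [attnLayer, Pi.smul_apply, Finset.smul_sum]
  refine Finset.sum_congr rfl fun h _ => ?_
  rw [← Matrix.mulVec_smul, Finset.smul_sum]
  congr 1
  refine Finset.sum_congr rfl fun j _ => ?_
  rw [Matrix.mulVec_smul, Matrix.mulVec_smul, Matrix.mulVec_smul, smul_dotProduct,
    dotProduct_smul]
  simp only [smul_smul, smul_eq_mul]
  congr 1
  ring

theorem attnStack_smul {H dx da n : ℕ} (L : ℕ) (W : Fin L → LayerWeights H dx da) (t : ℝ)
    (x : Fin n → Fin dx → ℝ) : attnStack L W (t • x) = t ^ 3 ^ L • attnStack L W x := by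
  induction L with
  | zero => simp [attnStack]
  | succ L ih => rw [attnStack, attnStack, ih, attnLayer_smul, ← pow_mul, pow_succ]

theorem inContextAssoc_smul {L H dx da V N : ℕ} (W : Weights L H dx da V)
    (S₁ S₂ : Fin N → Fin V) (i : Fin (N + N)) (p : Fin dx) (t : ℝ) (a b : Fin dx → ℝ) :
    inContextAssoc W S₁ S₂ i p (t • a) (t • b) =
      t ^ 3 ^ L * inContextAssoc W S₁ S₂ i p a b := by
  unfold inContextAssoc
  have h : Fin.append (fun j => embed W.emb (S₁ j) * (t • a))
      (fun j => embed W.emb (S₂ j) * (t • b)) =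
      t • Fin.append (fun j => embed W.emb (S₁ j) * a) (fun j => embed W.emb (S₂ j) * b) := by
    funext j
    refine Fin.addCases (fun j => ?_) (fun j => ?_) j
    · rw [Fin.append_left, Pi.smul_apply, Fin.append_left, mul_smul_comm]
    · rw [Fin.append_right, Pi.smul_apply, Fin.append_right, mul_smul_comm]
  rw [h, attnStack_smul]
  rfl

/-- The stack whose `l`-th layer is `w l`, with the embedding matrix of ones. -/
def uniformWeights {H dx da : ℕ} (L V : ℕ) (w : ℕ → LayerWeights H dx da) :
    Weights L H dx da V where
  layer l := w l
  emb := Matrix.of fun _ _ => 1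

/-- The input to the stack: `a` at the positions of the first sentence, `b` at those of the
second. -/
def twoBlock {dx : ℕ} (N : ℕ) (a b : Fin dx → ℝ) : Fin (N + N) → Fin dx → ℝ :=
  Fin.append (fun _ => a) (fun _ => b)

theorem inContextAssoc_uniformWeights {L H dx da V N : ℕ} (w : ℕ → LayerWeights H dx da)
    (S₁ S₂ : Fin N → Fin V) (i : Fin (N + N)) (p : Fin dx) (a b : Fin dx → ℝ) :
    inContextAssoc (uniformWeights L V w) S₁ S₂ i p a b =
      attnStack L (fun l => w l) (twoBlock N a b) i p := by
  have h : ∀ v : Fin V, embed (uniformWeights L V w).emb v = 1 := fun v => rfl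
  simp only [inContextAssoc, h, one_mul]
  rfl

theorem attnStack_succ {H dx da n : ℕ} (L : ℕ) (w : ℕ → LayerWeights H dx da)
    (x : Fin n → Fin dx → ℝ) : attnStack (L + 1) (fun l => w l) x =
      attnLayer (w L) (attnStack L (fun l => w l) x) := rfl

theorem sum_twoBlock {dx N : ℕ} (a b : Fin dx → ℝ) (f : (Fin dx → ℝ) → ℝ) :
    ∑ j, f (twoBlock N a b j) = N * (f a + f b) := by
  simp only [twoBlock, Fin.sum_univ_add, Fin.append_left, Fin.append_right, Finset.sum_const,
    Finset.card_univ, Fintype.card_fin, nsmul_eq_mul, mul_add]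

/-! ### Elementary attention layers -/

section Layers

variable {H dx da : ℕ} [NeZero da]

/-- The layer each of whose heads forms one product of three coordinates. -/
def monomialLayer (q k v o : Fin H → Fin dx) (c : ℝ) : LayerWeights H dx da where
  K h := Matrix.of fun i => if i = 0 then Pi.single (k h) 1 else 0
  Q h := Matrix.of fun i => if i = 0 then Pi.single (q h) 1 else 0
  V h := Matrix.of fun i => if i = 0 then Pi.single (v h) c else 0
  O h := Matrix.of fun x _ => if x = o h then 1 else 0

theorem attnLayer_monomialLayer {n : ℕ} (q k v o : Fin H → Fin dx) (c : ℝ)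
    (g : Fin n → Fin dx → ℝ) (i : Fin n) (x : Fin dx) :
    attnLayer (monomialLayer (da := da) q k v o c) g i x =
      ∑ h, if x = o h then g i (q h) * (c * ∑ j, g j (k h) * g j (v h)) else 0 := by
  simp only [attnLayer, monomialLayer, Finset.sum_apply, Matrix.mulVec, dotProduct,
    Matrix.of_apply, Pi.smul_apply, smul_eq_mul]
  refine Finset.sum_congr rfl fun h _ => ?_
  have key : ∀ (y : Fin dx) (d : ℝ) (u : Fin dx → ℝ) (r : Fin da),
      ∑ z, (if r = 0 then Pi.single y d else (0 : Fin dx → ℝ)) z * u z =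
        if r = 0 then d * u y else 0 := by
    intro y d u r
    split_ifs
    · exact single_dotProduct u d y
    · simp
  simp only [key]
  split_ifs
  · rw [Finset.mul_sum, Finset.mul_sum, Finset.sum_eq_single 0]
    · simp only [one_mul, if_true]
      refine Finset.sum_congr rfl fun j _ => ?_
      simp
      ring
    · intro r _ hr
      simp [hr]
    · simp
  · simp

/-- The layer whose output at the `i`-th position is, up to the constant `c`, the sum of all
vectors weighted by their `p`-th coordinates and by that of the `i`-th vector. -/
def averagingLayer (p : Fin (H * da)) (c : ℝ) : LayerWeights H (H * da) da where
  K _ := Matrix.of fun i => if i = 0 then Pi.single p 1 else 0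
  Q _ := Matrix.of fun i => if i = 0 then Pi.single p 1 else 0
  V h := Matrix.of fun i => Pi.single (finProdFinEquiv (h, i)) c
  O h := Matrix.of fun x i => if x = finProdFinEquiv (h, i) then 1 else 0

theorem attnLayer_averagingLayer {n : ℕ} (p : Fin (H * da)) (c : ℝ)
    (g : Fin n → Fin (H * da) → ℝ) (i : Fin n) (x : Fin (H * da)) :
    attnLayer (averagingLayer p c) g i x = g i p * (c * ∑ j, g j p * g j x) := by
  simp only [attnLayer, averagingLayer, Finset.sum_apply, Matrix.mulVec, dotProduct,
    Matrix.of_apply, Pi.smul_apply, smul_eq_mul]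
  have key : ∀ (y : Fin (H * da)) (d : ℝ) (u : Fin (H * da) → ℝ) (r : Fin da),
      ∑ z, (if r = 0 then Pi.single y d else (0 : Fin (H * da) → ℝ)) z * u z =
        if r = 0 then d * u y else 0 := by
    intro y d u r
    split_ifs
    · exact single_dotProduct u d y
    · simp
  have key' : ∀ (y : Fin (H * da)) (d : ℝ) (u : Fin (H * da) → ℝ),
      ∑ z, (Pi.single y d : Fin (H * da) → ℝ) z * u z = d * u y :=
    fun y d u => single_dotProduct u d y
  simp only [key, key']
  simp only [Finset.mul_sum]
  obtain ⟨⟨h, r⟩, rfl⟩ := finProdFinEquiv.surjective x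
  rw [Finset.sum_eq_single h, Finset.sum_eq_single r]
  · simp only [if_true, one_mul]
    refine Finset.sum_congr rfl fun j _ => ?_
    simp
    ring
  · intro r' _ hr
    simp [-finProdFinEquiv_apply_val, hr.symm]
  · simp
  · intro h' _ hh
    simp [-finProdFinEquiv_apply_val, hh.symm]
  · simp

end Layers

/-! ### Small width: a network on one coordinate -/

section OneCoordinate

variable {H dx da : ℕ} [NeZero da]

/-- With `S = ∑ j, x j p ^ 2`, summing the squares of `x j p * S ^ D` over `j` gives `S ^ (2 * D +
1)`, so a layer sends `D` to `3 * D + 1` and preserves the form. -/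
theorem attnStack_monomialLayer_const (hH : 0 < H) (p : Fin dx) (L : ℕ) :
    ∃ (K : ℝ) (D : ℕ), 0 < K ∧ 2 * D + 1 = 3 ^ L ∧ ∀ {n : ℕ} (x : Fin n → Fin dx → ℝ) (i : Fin n),
      attnStack L (fun _ => monomialLayer (H := H) (da := da) (fun _ => p) (fun _ => p)
        (fun _ => p) (fun _ => p) 1) x i p = K * (x i p * (∑ j, x j p ^ 2) ^ D) := by
  induction L with
  | zero => exact ⟨1, 0, one_pos, by simp, fun x i => by simp [attnStack]⟩
  | succ L ih =>
    obtain ⟨K, D, hK, hD, hx⟩ := ih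
    refine ⟨H * K ^ 3, 3 * D + 1, by positivity, by rw [pow_succ]; omega, fun x i => ?_⟩
    rw [attnStack, attnLayer_monomialLayer]
    simp only [hx, if_true, Finset.sum_const, Finset.card_univ, Fintype.card_fin, nsmul_eq_mul]
    have h : ∀ j, K * (x j p * (∑ j, x j p ^ 2) ^ D) * (K * (x j p * (∑ j, x j p ^ 2) ^ D)) =
        K ^ 2 * ((∑ j, x j p ^ 2) ^ D) ^ 2 * x j p ^ 2 := fun j => by ring
    simp only [h, ← Finset.mul_sum]
    ring

theorem two_pow_le_epsSeqSep {L V N : ℕ} (hH : 0 < H) (S₁ S₂ : Fin N → Fin V) (i : Fin (N + N))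
    (p : Fin dx) (ε : ℝ) :
    ((2 ^ L : ℕ) : ℕ∞) ≤ epsSeqSep (L := L) ε (uniformWeights L V (fun _ =>
      monomialLayer (H := H) (da := da) (fun _ => p) (fun _ => p) (fun _ => p) (fun _ => p) 1))
        S₁ S₂ i p := by
  obtain ⟨K, D, hK, hD, hx⟩ := attnStack_monomialLayer_const (da := da) hH p L
  have hN : (0 : ℝ) < N := by
    have := i.pos
    exact_mod_cast (by omega : 0 < N)
  have hy : ∀ a b : Fin dx → ℝ, inContextAssoc (uniformWeights L V (fun _ =>
      monomialLayer (H := H) (da := da) (fun _ => p) (fun _ => p) (fun _ => p) (fun _ => p) 1))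
        S₁ S₂ i p a b = K * (twoBlock N a b i p * (N * (a p ^ 2 + b p ^ 2)) ^ D) := by
    intro a b
    rw [inContextAssoc_uniformWeights, hx, sum_twoBlock a b (fun v => v p ^ 2)]
  -- With `a = 2⁻ʳ` and `b = 2ˢ`, a row factor splits off `a² + b²` and leaves `1 + 4 ^ (r + s)`, so
  -- the polynomial is `(1 + X) ^ D`.
  have hval : ∀ r s : ℕ, (N : ℝ) * (((2 ^ r : ℝ)⁻¹) ^ 2 + (2 ^ s : ℝ) ^ 2) =
      N * (4 ^ r : ℝ)⁻¹ * (1 + 4 ^ r * 4 ^ s) := by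
    intro r s
    have h4 : ∀ k : ℕ, (4 : ℝ) ^ k = (2 ^ k) ^ 2 := fun k => by
      rw [← pow_mul, mul_comm k, pow_mul]; norm_num
    rw [h4, h4]
    field_simp
  have hcard : D + 1 ≤ (((1 + X) ^ D : ℕ[X]).map (Nat.castRingHom ℝ)).support.card :=
    le_card_support_map fun k hk => by
      rw [coeff_one_add_X_pow]
      exact (Nat.choose_pos (Nat.le_of_lt_succ hk)).ne'
  have h2 : 2 ^ L ≤ D + 1 := by
    have : ∀ n : ℕ, 2 * 2 ^ n ≤ 3 ^ n + 1 := by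
      intro n
      induction n with
      | zero => norm_num
      | succ n ih => rw [pow_succ, pow_succ]; have := Nat.one_le_pow n 3 (by norm_num); omega
    have := this L
    omega
  refine le_trans (Nat.cast_le.2 (h2.trans hcard)) ?_
  -- The remaining factor is the input at position `i`: a row factor in the first sentence, a column
  -- factor in the second.
  obtain ⟨w, w', hw, hw', hi⟩ : ∃ w w' : ℕ → ℝ, (∀ r, w r ≠ 0) ∧ (∀ s, w' s ≠ 0) ∧ ∀ r s,
      twoBlock (dx := dx) N (fun _ => (2 ^ r : ℝ)⁻¹) (fun _ => 2 ^ s) i p = w r * w' s := by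
    refine Fin.addCases (fun j => ?_) (fun j => ?_) i
    · refine ⟨fun r => (2 ^ r : ℝ)⁻¹, fun _ => 1, fun r => by positivity, fun s => by simp, ?_⟩
      intro r s
      rw [twoBlock, Fin.append_left, mul_one]
    · refine ⟨fun _ => 1, fun s => 2 ^ s, fun r => by simp, fun s => by positivity, ?_⟩
      intro r s
      rw [twoBlock, Fin.append_right, one_mul]
  refine card_support_le_epsSepRank (m := 3 ^ L) (by positivity)
    (fun t a b => inContextAssoc_smul _ S₁ S₂ i p t a b) _ (q := 4) (by norm_num)
    (fun r _ => (2 ^ r : ℝ)⁻¹) (fun s _ => 2 ^ s)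
    (fun r => K * (w r * (N * (4 ^ r : ℝ)⁻¹) ^ D)) w'
    (fun r => mul_ne_zero hK.ne' (mul_ne_zero (hw r) (by positivity))) hw' (fun r s => ?_) ε
  rw [hy, hi, hval, mul_pow]
  simp
  ring

end OneCoordinate

/-! ### Products of block polynomials contain all small exponents -/

/-- The exponents are `0` and then the powers of `B`. -/
def slotExponent (B s : ℕ) : ℕ := if s = 0 then 0 else B ^ (s - 1)

/-- The sum of the monomials in the slots of the residue classes of `0` and `h` modulo `H`. -/
noncomputable def blockPoly (H da B h : ℕ) : ℕ[X] :=
  ∑ h' : Fin H, if (h' : ℕ) = 0 ∨ (h' : ℕ) = h then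
    ∑ i : Fin da, if 9 * ((h' : ℕ) + H * i) < H * da then
      X ^ slotExponent B ((h' : ℕ) + H * i) else 0
  else 0

theorem coeff_sum_ne_zero {ι : Type*} {s : Finset ι} {P : ι → ℕ[X]} {k : ℕ} {i : ι} (hi : i ∈ s)
    (h : (P i).coeff k ≠ 0) : (∑ i ∈ s, P i).coeff k ≠ 0 := by
  rw [finsetSum_coeff]
  have hle := Finset.single_le_sum (f := fun i => (P i).coeff k) (fun _ _ => Nat.zero_le _) hi
  exact ((Nat.pos_of_ne_zero h).trans_le hle).ne'

theorem coeff_blockPoly_ne_zero {H da B h s : ℕ} (hs : 9 * s < H * da)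
    (hh : s % H = 0 ∨ s % H = h) : (blockPoly H da B h).coeff (slotExponent B s) ≠ 0 := by
  have hH : 0 < H := Nat.pos_of_ne_zero fun h0 => by simp [h0] at hs
  have hdiv : s / H < da := Nat.div_lt_of_lt_mul (by omega)
  refine coeff_sum_ne_zero (Finset.mem_univ (⟨s % H, Nat.mod_lt _ hH⟩ : Fin H)) ?_
  rw [if_pos hh]
  refine coeff_sum_ne_zero (Finset.mem_univ (⟨s / H, hdiv⟩ : Fin da)) ?_
  simp only [Nat.mod_add_div, if_pos hs, coeff_X_pow, if_true]
  exact one_ne_zero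

theorem coeff_prod_blockPoly_ne_zero {H da n J E : ℕ} (hJ : 9 * J < H * da)
    (hn : J + H * da * E < n) :
    ∀ k < (E + 2) ^ J,
      (∏ i ∈ Finset.range n, blockPoly H da (E + 2) (i % H)).coeff k ≠ 0 := by
  intro k hk
  have hzero : ∀ h, (blockPoly H da (E + 2) h).coeff 0 ≠ 0 := fun h =>
    coeff_blockPoly_ne_zero (s := 0) (by omega) (Or.inl (Nat.zero_mod H))
  -- For each `s < J` this reserves `E + 1` factors containing `X ^ (E + 2) ^ s`: shifts by `H * da`
  -- preserve the residue modulo `H` and keep the indices distinct. The unreserved factors supply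
  -- their constant terms.
  let φ : ℕ × ℕ → ℕ := fun x => x.1 + 1 + H * da * x.2
  let T := Finset.range J ×ˢ Finset.range (E + 1)
  have hinj : Set.InjOn φ T := by
    rintro ⟨s, a⟩ hs ⟨s', a'⟩ hs' h
    simp only [T, Finset.coe_product, Set.mem_prod, Finset.coe_range, Set.mem_Iio] at hs hs'
    simp only [φ] at h
    have h1 : s + 1 = s' + 1 := by
      have := congrArg (· % (H * da)) h
      simpa only [Nat.add_mul_mod_self_left, Nat.mod_eq_of_lt (by omega : s + 1 < H * da),
        Nat.mod_eq_of_lt (by omega : s' + 1 < H * da)] using this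
    have h2 : a = a' := by
      rw [h1] at h
      exact Nat.eq_of_mul_eq_mul_left (by omega) (Nat.add_left_cancel h)
    simp [Nat.succ.inj h1, h2]
  have hsub : T.image φ ⊆ Finset.range n := by
    intro m hm
    obtain ⟨⟨s, a⟩, hs, rfl⟩ := Finset.mem_image.1 hm
    simp only [T, Finset.mem_product, Finset.mem_range] at hs
    have : H * da * a ≤ H * da * E := Nat.mul_le_mul_left _ (by omega)
    simp only [φ, Finset.mem_range]
    omega
  rw [← Finset.prod_sdiff hsub, Finset.prod_image hinj, Finset.prod_product]
  have hmod : ∀ s a, φ (s, a) % H = (s + 1) % H := fun s a => by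
    simp only [φ, mul_assoc, Nat.add_mul_mod_self_left]
  simp only [hmod, Finset.prod_const, Finset.card_range]
  have hdig := coeff_prod_pow_ne_zero (fun s => blockPoly H da (E + 2) ((s + 1) % H)) (E + 1) J
    (fun s _ => hzero _) (fun s hs => by
      simpa [slotExponent] using coeff_blockPoly_ne_zero (B := E + 2) (s := s + 1)
        (by omega : 9 * (s + 1) < H * da) (Or.inr rfl)) k hk
  simpa using coeff_mul_ne_zero (coeff_prod_zero_ne_zero _ _ fun i _ => hzero (i % H)) hdig

/-! ### Large width: averaging, pairing and the product tree -/

/-- An enumeration of the coordinates that starts with `p`. -/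
def coord {dx : ℕ} [NeZero dx] (p : Fin dx) (j : ℕ) : Fin dx :=
  Equiv.swap 0 p (Fin.ofNat dx j)

/-- The place of a coordinate in the enumeration `coord p`. -/
def place {dx : ℕ} [NeZero dx] (p x : Fin dx) : ℕ := (Equiv.swap 0 p x : Fin dx)

theorem coord_zero {dx : ℕ} [NeZero dx] (p : Fin dx) : coord p 0 = p := by
  simp [coord]

theorem place_coord {dx : ℕ} [NeZero dx] (p : Fin dx) {j : ℕ} (hj : j < dx) :
    place p (coord p j) = j := by
  simp [place, coord, Nat.mod_eq_of_lt hj]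

theorem coord_inj {dx : ℕ} [NeZero dx] (p : Fin dx) {j k : ℕ} (hj : j < dx) (hk : k < dx) :
    coord p j = coord p k ↔ j = k :=
  ⟨fun h => by rw [← place_coord p hj, h, place_coord p hk], fun h => h ▸ rfl⟩

section Layers

variable {H da : ℕ} [NeZero da] [NeZero (H * da)]

/-- The layer whose heads form sums of products of pairs of coordinates: the `i`-th row of the
head `h` holds the pair numbered `h + H * i`. The sum of the head `0` is added to all outputs. -/
def pairingLayer (p : Fin (H * da)) (c : ℝ) : LayerWeights H (H * da) da where
  K h := Matrix.of fun i => Pi.single (coord p (2 * ((h : ℕ) + H * i))) 1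
  Q h := Matrix.of fun i => if 9 * ((h : ℕ) + H * i) < H * da then
    Pi.single (coord p (2 * ((h : ℕ) + H * i) - 1)) 1 else 0
  V _ := Matrix.of fun i => if i = 0 then Pi.single p c else 0
  O h := Matrix.of fun x _ => if (h : ℕ) = 0 ∨ x = coord p h then 1 else 0

theorem attnLayer_pairingLayer {n : ℕ} (p : Fin (H * da)) (c : ℝ)
    (g : Fin n → Fin (H * da) → ℝ) (i : Fin n) (x : Fin (H * da)) :
    attnLayer (pairingLayer p c) g i x =
      ∑ h : Fin H, if (h : ℕ) = 0 ∨ x = coord p h then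
        ∑ j, (∑ r : Fin da, if 9 * ((h : ℕ) + H * r) < H * da then
          g i (coord p (2 * ((h : ℕ) + H * r) - 1)) * g j (coord p (2 * ((h : ℕ) + H * r))) else 0) *
            (c * g j p) else 0 := by
  simp only [attnLayer, pairingLayer, Finset.sum_apply, Matrix.mulVec, dotProduct,
    Matrix.of_apply, Pi.smul_apply, smul_eq_mul]
  refine Finset.sum_congr rfl fun h _ => ?_
  have key : ∀ (y : Fin (H * da)) (d : ℝ) (u : Fin (H * da) → ℝ) (φ : Prop) [Decidable φ],
      ∑ z, (if φ then Pi.single y d else (0 : Fin (H * da) → ℝ)) z * u z =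
        if φ then d * u y else 0 := by
    intro y d u φ _
    split_ifs
    · exact single_dotProduct u d y
    · simp
  have key' : ∀ (y : Fin (H * da)) (d : ℝ) (u : Fin (H * da) → ℝ),
      ∑ z, (Pi.single y d : Fin (H * da) → ℝ) z * u z = d * u y :=
    fun y d u => single_dotProduct u d y
  simp only [key, key']
  split_ifs
  · rw [Finset.sum_eq_single 0]
    · simp
    · intro r _ hr
      simp [hr]
    · simp
  · simp

/-- The layers of the network: averaging, pairing, and then a ternary product tree. -/
noncomputable def treeLayers (p : Fin (H * da)) (N : ℕ) : ℕ → LayerWeights H (H * da) da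
  | 0 => averagingLayer p ((N + N : ℕ) : ℝ)⁻¹
  | 1 => pairingLayer p ((N + N : ℕ) : ℝ)⁻¹
  | _ + 2 => monomialLayer (fun h => coord p (3 * (h : ℕ) % H))
      (fun h => coord p ((3 * (h : ℕ) + 1) % H)) (fun h => coord p ((3 * (h : ℕ) + 2) % H))
      (fun h => coord p h) ((N + N : ℕ) : ℝ)⁻¹

/-- The input vector that is nonzero at `p` and at the places of the given parity. -/
noncomputable def curve (p : Fin (H * da)) (B : ℕ) (e : ℕ) (τ : ℝ) : Fin (H * da) → ℝ :=
  fun x => if place p x = 0 then 1 else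
    if (place p x + e) % 2 = 0 then 2 * τ ^ B ^ ((place p x - 1) / 2) else 0

theorem attnStack_treeLayers_two {N : ℕ} (hN : 0 < N) (p : Fin (H * da)) (B : ℕ) (τ σ : ℝ)
    (i : Fin (N + N)) {h : ℕ} (hh : h < H) :
    attnStack 2 (fun l => treeLayers p N l) (twoBlock N (curve p B 1 τ) (curve p B 0 σ)) i
      (coord p h) = (blockPoly H da B h).eval₂ (Nat.castRingHom ℝ) (τ * σ) := by
  have hdx : 0 < H * da := Nat.pos_of_ne_zero (NeZero.ne _)
  have hda : 1 ≤ da := Nat.pos_of_ne_zero (NeZero.ne _)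
  have hHle : H ≤ H * da := Nat.le_mul_of_pos_right H hda
  have hN' : ((N + N : ℕ) : ℝ) ≠ 0 := by positivity
  have hp : place p p = 0 := by
    simpa [coord_zero] using place_coord p hdx
  have hone : ∀ j, twoBlock N (curve p B 1 τ) (curve p B 0 σ) j p = 1 := by
    intro j
    refine Fin.addCases (fun j => ?_) (fun j => ?_) j
    · simp [twoBlock, Fin.append_left, curve, hp]
    · rw [twoBlock, Fin.append_right]
      simp [curve, hp]
  have h1 : attnStack 1 (fun l => treeLayers p N l)
      (twoBlock N (curve p B 1 τ) (curve p B 0 σ)) =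
      fun _ x => (curve p B 1 τ x + curve p B 0 σ x) / 2 := by
    funext j x
    rw [attnStack_succ]
    simp only [attnStack, treeLayers]
    rw [attnLayer_averagingLayer]
    simp only [hone, one_mul]
    rw [sum_twoBlock _ _ (fun v => v x)]
    push_cast at hN' ⊢
    field_simp
    ring
  -- On the paired coordinates the curves have disjoint supports: odd places come from the first
  -- sentence, even positive places from the second. The factor `2` in `curve` cancels the halving
  -- by the average.
  have hu : ∀ s, 9 * s < H * da →
      (curve p B 1 τ (coord p (2 * s - 1)) + curve p B 0 σ (coord p (2 * s - 1))) / 2 *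
        ((curve p B 1 τ (coord p (2 * s)) + curve p B 0 σ (coord p (2 * s))) / 2) =
        (τ * σ) ^ slotExponent B s := by
    intro s hs
    simp only [curve, place_coord p (by omega : 2 * s - 1 < H * da),
      place_coord p (by omega : 2 * s < H * da)]
    rcases s with _ | s
    -- Truncated subtraction makes slot `0` the pair `(p, p)`, of value `1`; this is the constant
    -- term of every block.
    · simp [slotExponent]
    · have e1 : (2 * (s + 1) - 1 - 1) / 2 = s := by omega
      have e2 : (2 * (s + 1) - 1) / 2 = s := by omega
      have e3 : (2 * (s + 1) - 1 + 1) % 2 = 0 := by omega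
      have e4 : ¬ (2 * (s + 1) - 1 + 0) % 2 = 0 := by omega
      have e5 : ¬ (2 * (s + 1) + 1) % 2 = 0 := by omega
      have e6 : (2 * (s + 1) + 0) % 2 = 0 := by omega
      have e7 : ¬ 2 * (s + 1) - 1 = 0 := by omega
      have e8 : ¬ 2 * (s + 1) = 0 := by omega
      rw [if_neg e7, if_neg e7, if_neg e8, if_neg e8, if_pos e3, if_neg e4, if_neg e5, if_pos e6,
        e1, e2, slotExponent, if_neg (Nat.succ_ne_zero s), Nat.add_sub_cancel, mul_pow]
      ring
  have hup : (curve p B 1 τ p + curve p B 0 σ p) / 2 = 1 := by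
    simp [curve, hp]
  rw [attnStack_succ, h1]
  simp only [treeLayers]
  rw [attnLayer_pairingLayer]
  simp only [hup, Finset.sum_const, Finset.card_univ, Fintype.card_fin, nsmul_eq_mul]
  rw [blockPoly, eval₂_finsetSum]
  refine Finset.sum_congr rfl fun h' _ => ?_
  simp only [coord_inj p (hh.trans_le hHle) (h'.2.trans_le hHle), @eq_comm _ h]
  split_ifs
  · rw [eval₂_finsetSum, mul_one, mul_left_comm, mul_inv_cancel₀ hN', mul_one]
    refine Finset.sum_congr rfl fun r _ => ?_
    split_ifs with hr
    · rw [hu _ hr, eval₂_X_pow]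
    · simp
  · simp

/-- Node `h` multiplies nodes `3 * h`, `3 * h + 1`, `3 * h + 2`, so its leaves after `l` levels are
the `3 ^ l` consecutive indices from `3 ^ l * h` on, read modulo `H`. -/
theorem attnStack_treeLayers {N : ℕ} (hN : 0 < N) (p : Fin (H * da)) (B : ℕ) (τ σ : ℝ) (l : ℕ)
    (i : Fin (N + N)) (h : ℕ) :
    attnStack (l + 2) (fun l => treeLayers p N l)
      (twoBlock N (curve p B 1 τ) (curve p B 0 σ)) i (coord p (h % H)) =
      ∏ k ∈ Finset.range (3 ^ l),
        (blockPoly H da B ((3 ^ l * h + k) % H)).eval₂ (Nat.castRingHom ℝ) (τ * σ) := by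
  have hdx : H * da ≠ 0 := NeZero.ne _
  have hH : 0 < H := Nat.pos_of_ne_zero (left_ne_zero_of_mul hdx)
  have hHle : H ≤ H * da := Nat.le_mul_of_pos_right H (Nat.pos_of_ne_zero (NeZero.ne _))
  have hN' : ((N + N : ℕ) : ℝ) ≠ 0 := by positivity
  induction l generalizing i h with
  | zero =>
    rw [attnStack_treeLayers_two hN p B τ σ i (Nat.mod_lt h hH)]
    simp
  | succ l ih =>
    rw [show l + 1 + 2 = (l + 2) + 1 from rfl, attnStack_succ, treeLayers, attnLayer_monomialLayer,
      Finset.sum_eq_single (⟨h % H, Nat.mod_lt h hH⟩ : Fin H)]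
    · simp only [if_true, ih, Finset.sum_const, Finset.card_univ, Fintype.card_fin, nsmul_eq_mul]
      rw [inv_mul_cancel_left₀ hN', show 3 ^ (l + 1) = 3 ^ l + 3 ^ l + 3 ^ l by ring,
        Finset.prod_range_add, Finset.prod_range_add, mul_assoc]
      have hmod : ∀ c k : ℕ, (3 ^ l * (3 * (h % H) + c) + k) % H =
          ((3 ^ l + 3 ^ l + 3 ^ l) * h + (3 ^ l * c + k)) % H := by
        intro c k
        have : (3 ^ l * (3 * (h % H) + c) + k) ≡
            (3 ^ l * (3 * h + c) + k) [MOD H] :=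
          (((Nat.mod_modEq h H).mul_left 3).add_right c |>.mul_left _).add_right k
        rw [this]
        congr 1
        ring
      have h0 := fun k => hmod 0 k
      simp only [add_zero, mul_zero, zero_add] at h0
      simp only [h0, hmod]
      congr 2
      · simp only [mul_one, add_assoc]
      · refine Finset.prod_congr rfl fun k _ => ?_
        congr 3
        ring
    · intro h' _ hne
      rw [if_neg]
      rw [coord_inj p ((Nat.mod_lt h hH).trans_le hHle) (h'.2.trans_le hHle)]
      intro heq
      exact hne (Fin.ext heq.symm)
    · simp

theorem pow_le_epsSeqSep_treeLayers {V N l J E : ℕ} (hJ : 9 * J < H * da)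
    (hn : J + H * da * E < 3 ^ l) (S₁ S₂ : Fin N → Fin V) (i : Fin (N + N)) (p : Fin (H * da))
    (ε : ℝ) :
    (((E + 2) ^ J : ℕ) : ℕ∞) ≤
      epsSeqSep ε (uniformWeights (l + 2) V (treeLayers p N)) S₁ S₂ i p := by
  have hN : 0 < N := by
    have := i.pos
    omega
  refine le_trans (Nat.cast_le.2 (le_card_support_map (coeff_prod_blockPoly_ne_zero hJ hn))) ?_
  refine card_support_le_epsSepRank (m := 3 ^ (l + 2)) (by positivity)
    (fun t a b => inContextAssoc_smul _ S₁ S₂ i p t a b) _ (q := 2) (by norm_num)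
    (fun r => curve p (E + 2) 1 (2 ^ r)) (fun s => curve p (E + 2) 0 (2 ^ s)) (fun _ => 1)
    (fun _ => 1) (fun _ => one_ne_zero) (fun _ => one_ne_zero) (fun r s => ?_) ε
  have h := attnStack_treeLayers hN p (E + 2) (2 ^ r) (2 ^ s) l i 0
  rw [Nat.zero_mod, coord_zero] at h
  rw [inContextAssoc_uniformWeights, h, one_mul, mul_one, eval_map, eval₂_finsetProd]
  simp

end Layers

/-! ### Logarithmic estimates -/

theorem coe_le_log_of_le {x : ℝ} {R : ℕ} {M : ℕ∞} (hR : 0 < R) (hx : x ≤ Real.log R)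
    (hM : (R : ℕ∞) ≤ M) : (x : EReal) ≤ ENNReal.log (M : ENNReal) := by
  have hR' : (0 : ℝ) < R := by exact_mod_cast hR
  have h1 : ((R : ℝ) : EReal) = R := by simp
  calc (x : EReal) ≤ (Real.log R : EReal) := EReal.coe_le_coe_iff.2 hx
    _ = ENNReal.log (ENNReal.ofReal R) := (ENNReal.log_ofReal_of_pos hR').symm
    _ ≤ _ := ENNReal.log_monotone (by
      rw [ENNReal.ofReal_natCast]
      exact_mod_cast hM)

theorem one_add_log_le_logTerms (L dx H : ℕ) : 1 + Real.log dx ≤ logTerms L dx H := by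
  have h1 := Real.log_natCast_nonneg L
  have h2 := Real.log_natCast_nonneg H
  unfold logTerms
  linarith

theorem one_le_logTerms (L dx H : ℕ) : 1 ≤ logTerms L dx H := by
  have h1 := one_add_log_le_logTerms L dx H
  have h2 := Real.log_natCast_nonneg dx
  linarith

theorem log_two_pow_ge {L dx H : ℕ} (hdx : dx ≤ 9) :
    1 / 144 * ((L : ℝ) * dx) / logTerms L dx H ^ 1 ≤ Real.log (2 ^ L : ℕ) := by
  have hΛ := one_le_logTerms L dx H
  have hdx' : (dx : ℝ) ≤ 9 := by exact_mod_cast hdx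
  have hL : (0 : ℝ) ≤ L := Nat.cast_nonneg L
  push_cast
  rw [Real.log_pow, pow_one]
  have h2 := Real.log_two_gt_d9
  calc 1 / 144 * ((L : ℝ) * dx) / logTerms L dx H ≤ 1 / 144 * ((L : ℝ) * dx) :=
        div_le_self (by positivity) hΛ
    _ ≤ L * (1 / 2) := by nlinarith
    _ ≤ L * Real.log 2 := mul_le_mul_of_nonneg_left (by linarith) hL

theorem log_base_ge {l dx H B : ℕ} (hdx : 0 < dx) (hB : 2 ≤ B) (hB' : 3 ^ l ≤ B * dx) :
    1 / 8 * ((l + 2 : ℕ) : ℝ) / logTerms (l + 2) dx H ≤ Real.log B := by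
  have hΛ := one_add_log_le_logTerms (l + 2) dx H
  have hΛ1 := one_le_logTerms (l + 2) dx H
  have hlogdx := Real.log_natCast_nonneg dx
  have hBpos : (0 : ℝ) < B := by exact_mod_cast (by omega : 0 < B)
  have hdxpos : (0 : ℝ) < dx := by exact_mod_cast hdx
  have hlog2 : Real.log 2 ≤ Real.log B :=
    Real.log_le_log two_pos (by exact_mod_cast hB)
  have h2 := Real.log_two_gt_d9
  have hl : (0 : ℝ) ≤ l := Nat.cast_nonneg l
  have h3 : (1 : ℝ) ≤ Real.log 3 := by
    rw [Real.le_log_iff_exp_le (by norm_num)]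
    linarith [Real.exp_one_lt_d9]
  have hsum : l * Real.log 3 ≤ Real.log B + Real.log dx := by
    rw [← Real.log_pow, ← Real.log_mul hBpos.ne' hdxpos.ne']
    exact Real.log_le_log (by positivity) (by exact_mod_cast hB')
  rw [div_le_iff₀ (by linarith)]
  push_cast
  -- If the depth is at most of order `log dx`, dividing by `logTerms` makes `B ≥ 2` sufficient.
  -- Otherwise `log dx` is absorbed in `l * log 3 ≤ log B + log dx`.
  by_cases hcase : (l : ℝ) + 2 ≤ 4 * (1 + Real.log dx)
  · nlinarith
  · push Not at hcase
    have : (l : ℝ) ≤ l * Real.log 3 := le_mul_of_one_le_right hl h3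
    have hB4 : ((l : ℝ) + 2) / 8 ≤ Real.log B := by linarith
    have := Real.log_natCast_nonneg B
    nlinarith

theorem log_pow_ge {l dx H B J : ℕ} (hJ : dx ≤ 18 * J) (hdx : 0 < dx) (hB : 2 ≤ B)
    (hB' : 3 ^ l ≤ B * dx) :
    1 / 144 * (((l + 2 : ℕ) : ℝ) * dx) / logTerms (l + 2) dx H ^ 1 ≤ Real.log (B ^ J : ℕ) := by
  have hbase := log_base_ge (H := H) hdx hB hB'
  have hJ' : (dx : ℝ) ≤ 18 * J := by exact_mod_cast hJ
  have hlogB := Real.log_natCast_nonneg B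
  push_cast at hbase ⊢
  rw [Real.log_pow, pow_one]
  calc 1 / 144 * (((l : ℝ) + 2) * dx) / logTerms (l + 2) dx H
      = dx / 18 * (1 / 8 * ((l : ℝ) + 2) / logTerms (l + 2) dx H) := by ring
    _ ≤ dx / 18 * Real.log B := mul_le_mul_of_nonneg_left hbase (by positivity)
    _ ≤ J * Real.log B := mul_le_mul_of_nonneg_right (by linarith) hlogB

theorem lt_three_pow_of_logb_lt {L dx : ℕ} (hdx : 0 < dx) (h : Real.logb 3 dx < L) :
    dx < 3 ^ L := by
  have := (Real.logb_lt_iff_lt_rpow (by norm_num) (by exact_mod_cast hdx)).1 h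
  rw [Real.rpow_natCast] at this
  exact_mod_cast this

end InContext

/-! ### The two ranges of the width -/

/-- The network output is homogeneous of degree `3 ^ L` in the association vectors, so the
separation rank of a uniform approximation is bounded below by that of the output itself,
whatever the size of `ε`. -/
theorem theorem2 :
    -- `C` and `m` are the constant and the power of logarithms hidden in the bound on `ε`,
    -- `c` and `k` those hidden in the lower bound on the rank
    ∀ (C : ℝ) (m : ℕ), 0 < C → ∃ (c : ℝ) (k : ℕ), 0 < c ∧
      ∀ (L H dx da V N : ℕ), dx = H * da → Real.logb 3 (dx : ℝ) < (L : ℝ) →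
      ∀ (p : Fin dx) (i : Fin (N + N)),
      ∃ W : InContext.Weights L H dx da V,
        ∀ (S₁ S₂ : Fin N → Fin V) (ε : ℝ), 0 < ε →
          ε ≤ C * InContext.logTerms L dx H ^ m *
            ((Nat.choose (3 ^ L + dx - 1) (3 ^ L) : ℕ) : ℝ)⁻¹ →
          ((c * ((L : ℝ) * (dx : ℝ)) / InContext.logTerms L dx H ^ k : ℝ) : EReal) ≤
            ENNReal.log ((InContext.epsSeqSep ε W S₁ S₂ i p : ℕ∞) : ENNReal) := by
  intro C m _
  refine ⟨1 / 144, 1, by norm_num, ?_⟩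
  intro L H dx da V N hdx hL p i
  subst hdx
  have hpos : 0 < H * da := p.pos
  have hlt := InContext.lt_three_pow_of_logb_lt hpos hL
  have hH : 0 < H := Nat.pos_of_mul_pos_right hpos
  have : NeZero da := ⟨(Nat.pos_of_mul_pos_left hpos).ne'⟩
  have : NeZero (H * da) := ⟨hpos.ne'⟩
  by_cases hsmall : H * da ≤ 9
  · refine ⟨InContext.uniformWeights L V fun _ => InContext.monomialLayer (fun _ => p)
      (fun _ => p) (fun _ => p) (fun _ => p) 1, fun S₁ S₂ ε _ _ => ?_⟩
    exact InContext.coe_le_log_of_le (by positivity) (InContext.log_two_pow_ge hsmall)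
      (InContext.two_pow_le_epsSeqSep (da := da) hH S₁ S₂ i p ε)
  · push Not at hsmall
    obtain ⟨l, rfl⟩ : ∃ l, L = l + 2 := by
      refine ⟨L - 2, ?_⟩
      have : 2 ≤ L := by
        by_contra hlt2
        have : 3 ^ L ≤ 3 ^ 1 := Nat.pow_le_pow_right (by norm_num) (by omega)
        omega
      omega
    rw [pow_add] at hlt
    -- The divisor `9 = 3 ^ 2` pays for the two layers before the tree: `dx < 3 ^ L` gives only `dx
    -- < 9 * 3 ^ l`.
    have hJ : (H * da - 1) / 9 < 3 ^ l := by omega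
    -- `J` is the largest integer with `9 * J < dx`, and `E = B - 2` the largest with `J + dx * E <
    -- 3 ^ l`. Since `dx > 9`, also `J ≥ 1`, whence `dx ≤ 18 * J`.
    refine ⟨InContext.uniformWeights (l + 2) V (InContext.treeLayers p N),
      fun S₁ S₂ ε _ _ => InContext.coe_le_log_of_le ?_ (InContext.log_pow_ge
      (J := (H * da - 1) / 9) (B := (3 ^ l - 1 - (H * da - 1) / 9) / (H * da) + 2)
      (by omega) hpos (Nat.le_add_left 2 _) ?_)
      (InContext.pow_le_epsSeqSep_treeLayers (by omega) ?_ S₁ S₂ i p ε)⟩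
    · positivity
    · have h1 := Nat.lt_mul_div_succ (3 ^ l - 1 - (H * da - 1) / 9) hpos
      have h2 : ((3 ^ l - 1 - (H * da - 1) / 9) / (H * da) + 2) * (H * da) =
          H * da * ((3 ^ l - 1 - (H * da - 1) / 9) / (H * da) + 1) + H * da := by ring
      omega
    · have h1 := Nat.mul_div_le (3 ^ l - 1 - (H * da - 1) / 9) (H * da)
      omega
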